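/- A hypergraph $H=(V,E)$ consists of a set $V$ of vertices and a set $E$ of hyperedges, which are subsets of $V$. For natural numbers $t,k$, a $t$-tuple of $H$ is a subset of $V$ of size $t$, and a $t$-tuple $k$-coloring of $H$ is a map from the set of its $t$-tuples to a set of $k$ colors; it is called $(t,k,f)$-polychromatic if every hyperedge $e\in E$ with $|e|\ge f$ contains (as subsets of $e$) $t$-tuples of all the $k$ colors. Let $f_H(t,k)$ be the least natural number $f$ such that $H$ has a $(t,k,f)$-polychromatic coloring ($\infty$ if there is none), and for a family $\mathcal H$ of hypergraphs let $f_{\mathcal H}(t,k)$ be the maximum of $f_H(t,k)$ over all $H\in\mathcal H$ ($\infty$ if these numbers are unbounded). Let $\mathcal H$ be the family of all hypergraphs obtained from a finite set $P$ of points in $\mathbb R^2$ by taking $V=P$ and $E=\{h\cap P : h \text{ is a closed halfplane in } \mathbb R^2\}$. Then for every integer $t\ge 2$, $$f_{\mathcal H}(t,2)=t+1.$$ -/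

import Mathlib

/-- The `t`-tuples of a hypergraph `H`: the `t`-element subsets of its vertex set. -/
abbrev Hypergraph.Tuple {α : Type*} (H : Hypergraph α) (t : ℕ) : Type _ :=
  {s : Finset α // (s : Set α) ⊆ H.vertexSet ∧ s.card = t}

/-- A `t`-tuple `k`-coloring `c` of `H` is `(t, k, f)`-polychromatic if every hyperedge with at
least `f` vertices contains `t`-tuples of all the `k` colors. -/
def Hypergraph.IsPolychromatic {α : Type*} (H : Hypergraph α) {t k : ℕ} (f : ℕ)
    (c : H.Tuple t → Fin k) : Prop :=
  ∀ e ∈ H.edgeSet, (f : ℕ∞) ≤ e.encard →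
    ∀ i : Fin k, ∃ s : H.Tuple t, (s.1 : Set α) ⊆ e ∧ c s = i

/-- `f_H(t, k)`: the least `f` such that `H` has a `(t, k, f)`-polychromatic coloring
(`⊤` if there is no such `f`). -/
noncomputable def Hypergraph.polychromaticNumber {α : Type*} (H : Hypergraph α) (t k : ℕ) : ℕ∞ :=
  ⨅ (f : ℕ) (_ : ∃ c : H.Tuple t → Fin k, H.IsPolychromatic f c), (f : ℕ∞)

/-- `f_𝓗(t, k)` for a family `𝓗` of hypergraphs: the maximum of `f_H(t, k)` over `H ∈ 𝓗`
(`⊤` if these numbers are unbounded). -/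
noncomputable def familyPolychromaticNumber {α : Type*} (𝓗 : Set (Hypergraph α)) (t k : ℕ) : ℕ∞ :=
  ⨆ H ∈ 𝓗, H.polychromaticNumber t k

/-- The (closed) halfplanes of `ℝ²`. -/
def IsHalfplane (h : Set (EuclideanSpace ℝ (Fin 2))) : Prop :=
  ∃ (a : EuclideanSpace ℝ (Fin 2)) (b : ℝ), a ≠ 0 ∧ h = {x | b ≤ inner ℝ a x}

/-- The hypergraph on a set `P` of points in `ℝ²` whose hyperedges are the sets `h ∩ P`,
`h` a halfplane. -/
def halfplaneHypergraph (P : Set (EuclideanSpace ℝ (Fin 2))) :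
    Hypergraph (EuclideanSpace ℝ (Fin 2)) where
  vertexSet := P
  edgeSet := {e | ∃ h, IsHalfplane h ∧ e = h ∩ P}
  subset_vertexSet_of_mem_edgeSet' := by
    rintro e ⟨h, -, rfl⟩
    exact Set.inter_subset_right

/-- The family of hypergraphs defined by (finitely many) points and halfplanes in `ℝ²`. -/
def halfplaneFamily : Set (Hypergraph (EuclideanSpace ℝ (Fin 2))) :=
  {H | ∃ P : Set (EuclideanSpace ℝ (Fin 2)), P.Finite ∧ H = halfplaneHypergraph P}

/-! Upper bound: if the points are split into classes so that every halfplane with at least three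
points meets both, colour a `t`-tuple by the parity of its number of points in the class `N`. Among
`t + 1 ≥ 3` points of a hyperedge, dropping a point of `N` or one outside `N` gives tuples of
opposite parity.

For `N`, take a minimal set of extreme points meeting every halfplane with at least three points. If
such a halfplane lay inside `N`, it would shrink (`exists_subset_mem_edgeSet_ncard_eq`) to one
containing exactly three points `p, q, r` of `N`. By minimality each has a private hyperedge, hence
a further point beyond one of the two sides of the triangle at that vertex
(`exists_barycentric_sign`). The three points cannot all be beyond the same side, and two beyond
different sides contradict extremality of the common vertex (`false_of_barycentric_sign`).

Lower bound: `t` points have only one `t`-tuple. -/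

/-- The Euclidean plane. -/
abbrev Plane : Type := EuclideanSpace ℝ (Fin 2)

theorem mem_edgeSet_halfplaneHypergraph {P e : Set Plane} :
    e ∈ (halfplaneHypergraph P).edgeSet ↔
      ∃ (a : Plane) (b : ℝ), a ≠ 0 ∧ e = {x | x ∈ P ∧ b ≤ inner ℝ a x} := by
  constructor
  · rintro ⟨h, ⟨a, b, ha, rfl⟩, rfl⟩
    exact ⟨a, b, ha, by ext x; simp [and_comm]⟩
  · rintro ⟨a, b, ha, rfl⟩
    exact ⟨_, ⟨a, b, ha, rfl⟩, by ext x; simp [and_comm]⟩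

/-- Two vectors of the plane with the same inner products against `a ≠ 0` and against the
rotation of `a` by a right angle are equal. -/
theorem plane_eq_of_inner_eq {a x y : Plane} (ha : a ≠ 0) (h₁ : inner ℝ a x = inner ℝ a y)
    (h₂ : inner ℝ !₂[-a 1, a 0] x = inner ℝ !₂[-a 1, a 0] y) : x = y := by
  simp only [PiLp.inner_apply, Fin.sum_univ_two, RCLike.inner_apply, conj_trivial] at h₁ h₂
  simp at h₂
  have hpos : a 0 ^ 2 + a 1 ^ 2 ≠ 0 := by
    intro h0
    apply ha
    ext i
    fin_cases i
    · simp; nlinarith [sq_nonneg (a 0), sq_nonneg (a 1)]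
    · simp; nlinarith [sq_nonneg (a 0), sq_nonneg (a 1)]
  ext i
  refine mul_left_cancel₀ hpos ?_
  fin_cases i
  · show (a 0 ^ 2 + a 1 ^ 2) * x 0 = (a 0 ^ 2 + a 1 ^ 2) * y 0
    linear_combination a 0 * h₁ - a 1 * h₂
  · show (a 0 ^ 2 + a 1 ^ 2) * x 1 = (a 0 ^ 2 + a 1 ^ 2) * y 1
    linear_combination a 1 * h₁ + a 0 * h₂

/-! ### Shrinking hyperedges one point at a time -/

/-- Some point of a nonempty hyperedge can be cut off by a halfplane. -/
theorem exists_diff_singleton_mem_edgeSet {P e : Set Plane} (hP : P.Finite)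
    (he : e ∈ (halfplaneHypergraph P).edgeSet) (hne : e.Nonempty) :
    ∃ p ∈ e, e \ {p} ∈ (halfplaneHypergraph P).edgeSet := by
  obtain ⟨a, b, ha, rfl⟩ := mem_edgeSet_halfplaneHypergraph.1 he
  set e : Set Plane := {x | x ∈ P ∧ b ≤ inner ℝ a x} with he_def
  have hef : e.Finite := hP.subset fun x hx => hx.1
  set a' : Plane := !₂[-a 1, a 0] with ha'
  have horth : inner ℝ a a' = 0 := by
    simp [ha', PiLp.inner_apply, Fin.sum_univ_two]; ring
  -- Ties in the direction `a` are broken along the orthogonal `a'`, so a slight tilt of `a` towards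
  -- `a'` makes `p` the strict minimum on `e` while keeping the points outside `e` below it.
  obtain ⟨p, hp, hmin⟩ := Set.exists_min_image e
    (fun x => toLex ((inner ℝ a x : ℝ), (inner ℝ a' x : ℝ))) hef hne
  have hsmall : ∀ᶠ ε : ℝ in nhdsWithin 0 (Set.Ioi 0), ∀ x ∈ P, x ≠ p →
      (x ∈ e → inner ℝ (a + ε • a') p < inner ℝ (a + ε • a') x) ∧
      (x ∉ e → inner ℝ (a + ε • a') x < inner ℝ (a + ε • a') p) := by
    rw [Filter.eventually_all_finite hP]
    intro x hxP
    have hcont : ∀ y : Plane, Filter.Tendsto (fun ε : ℝ => inner ℝ (a + ε • a') y)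
        (nhdsWithin 0 (Set.Ioi 0)) (nhds (inner ℝ a y)) := by
      intro y
      have : Continuous fun ε : ℝ => (inner ℝ (a + ε • a') y : ℝ) := by fun_prop
      simpa using (this.tendsto 0).mono_left nhdsWithin_le_nhds
    by_cases hxp : x = p
    · simp [hxp]
    by_cases hxe : x ∈ e
    · rcases (Prod.Lex.le_iff.1 (hmin x hxe)) with h | ⟨h, h'⟩
      · filter_upwards [(hcont p).eventually_lt (hcont x) h] with ε hε _
        exact ⟨fun _ => hε, fun hx => absurd hxe hx⟩
      · have h : (inner ℝ a p : ℝ) = inner ℝ a x := h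
        have h' : (inner ℝ a' p : ℝ) ≤ inner ℝ a' x := h'
        have hlt : (inner ℝ a' p : ℝ) < inner ℝ a' x :=
          lt_of_le_of_ne h' fun h'' => hxp (plane_eq_of_inner_eq ha h h'').symm
        filter_upwards [self_mem_nhdsWithin] with ε hε _
        refine ⟨fun _ => ?_, fun hx => absurd hxe hx⟩
        simp only [inner_add_left, real_inner_smul_left, h]
        have := mul_lt_mul_of_pos_left hlt (show (0 : ℝ) < ε from hε)
        linarith
    · have h : (inner ℝ a x : ℝ) < inner ℝ a p :=
        lt_of_lt_of_le (not_le.1 fun h => hxe ⟨hxP, h⟩) hp.2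
      filter_upwards [(hcont x).eventually_lt (hcont p) h] with ε hε _
      exact ⟨fun hx => absurd hx hxe, fun _ => hε⟩
  obtain ⟨ε, hε⟩ := hsmall.exists
  refine ⟨p, hp, mem_edgeSet_halfplaneHypergraph.2 ?_⟩
  have hgap : ∃ b' : ℝ, inner ℝ (a + ε • a') p < b' ∧
      ∀ x ∈ e \ {p}, b' ≤ inner ℝ (a + ε • a') x := by
    rcases (e \ {p}).eq_empty_or_nonempty with h0 | h0
    · exact ⟨inner ℝ (a + ε • a') p + 1, by linarith, by simp [h0]⟩
    · obtain ⟨y, hy, hy'⟩ := Set.exists_min_image (e \ {p})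
        (fun x => (inner ℝ (a + ε • a') x : ℝ)) (hef.subset Set.sdiff_subset) h0
      exact ⟨_, (hε y hy.1.1 hy.2).1 hy.1, hy'⟩
  obtain ⟨b', hb', hb''⟩ := hgap
  refine ⟨a + ε • a', b', fun h0 => ?_, ?_⟩
  · have h1 : (inner ℝ a (a + ε • a') : ℝ) = 0 := by rw [h0, inner_zero_right]
    rw [inner_add_right, real_inner_smul_right, horth, mul_zero, add_zero] at h1
    exact ha (inner_self_eq_zero.1 h1)
  · ext x
    refine ⟨fun hx => ⟨hx.1.1, hb'' x hx⟩, fun hx => ?_⟩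
    have hxp : x ≠ p := fun h => by
      have := hx.2
      rw [h] at this
      linarith
    refine ⟨?_, hxp⟩
    by_contra hxe
    have := (hε x hx.1 hxp).2 hxe
    linarith [hx.2]

/-- A hyperedge contains hyperedges of every smaller size. -/
theorem exists_subset_mem_edgeSet_ncard_eq {P e : Set Plane} (hP : P.Finite)
    (he : e ∈ (halfplaneHypergraph P).edgeSet) {n : ℕ} (hn : n ≤ e.ncard) :
    ∃ e' ⊆ e, e' ∈ (halfplaneHypergraph P).edgeSet ∧ e'.ncard = n := by
  induction hm : e.ncard - n generalizing e with
  | zero => exact ⟨e, subset_rfl, he, by omega⟩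
  | succ m ih =>
    obtain ⟨p, hp, hp'⟩ := exists_diff_singleton_mem_edgeSet hP he
      (Set.nonempty_of_ncard_ne_zero (by omega))
    have hcard := Set.ncard_sdiff_singleton_of_mem hp
    obtain ⟨e', h1, h2⟩ := ih hp' (by omega) (by omega)
    exact ⟨e', h1.trans Set.sdiff_subset, h2⟩

/-! ### Barycentric coordinates and extreme points -/

/-- If each of three points of the plane is strictly extreme in the triple, then every point of
the plane has barycentric coordinates with respect to them. -/
theorem exists_barycentric_of_extreme {p q r : Plane}
    (hp : ∃ f : Plane, inner ℝ f q < inner ℝ f p ∧ inner ℝ f r < inner ℝ f p)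
    (hq : ∃ f : Plane, inner ℝ f p < inner ℝ f q ∧ inner ℝ f r < inner ℝ f q)
    (hr : ∃ f : Plane, inner ℝ f p < inner ℝ f r ∧ inner ℝ f q < inner ℝ f r) (w : Plane) :
    ∃ α β γ : ℝ, α + β + γ = 1 ∧ w = α • p + β • q + γ • r := by
  -- Twice the signed area of the triangle. If it vanishes, the points are collinear, and the middle
  -- one is not extreme.
  set D : ℝ := (q 0 - p 0) * (r 1 - p 1) - (q 1 - p 1) * (r 0 - p 0) with hD
  by_cases hD0 : D = 0
  · exfalso
    obtain ⟨f, hf1, hf2⟩ := hp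
    obtain ⟨g, hg1, hg2⟩ := hq
    obtain ⟨k, hk1, hk2⟩ := hr
    have hpq : (q 0 - p 0) ^ 2 + (q 1 - p 1) ^ 2 ≠ 0 := by
      intro h0
      have : p = q := by
        ext i
        fin_cases i
        · simp; nlinarith [sq_nonneg (q 0 - p 0), sq_nonneg (q 1 - p 1)]
        · simp; nlinarith [sq_nonneg (q 0 - p 0), sq_nonneg (q 1 - p 1)]
      exact hf1.ne (by rw [this])
    obtain ⟨s, hs⟩ : ∃ s : ℝ, r = (1 - s) • p + s • q := by
      refine ⟨((r 0 - p 0) * (q 0 - p 0) + (r 1 - p 1) * (q 1 - p 1)) /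
        ((q 0 - p 0) ^ 2 + (q 1 - p 1) ^ 2), ?_⟩
      ext i
      fin_cases i
      · simp; field_simp; linear_combination (-(q 1 - p 1)) * (hD.symm.trans hD0)
      · simp; field_simp; linear_combination (q 0 - p 0) * (hD.symm.trans hD0)
    have hin : ∀ f : Plane, (inner ℝ f r : ℝ) = (1 - s) * inner ℝ f p + s * inner ℝ f q := by
      intro f
      rw [hs, inner_add_right, real_inner_smul_right, real_inner_smul_right]
    rw [hin] at hf2 hg2 hk1 hk2
    have h1 : 0 < s := by nlinarith
    have h2 : s < 1 := by nlinarith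
    nlinarith
  -- Cramer's rule: ratios of signed areas.
  · refine ⟨((q 0 - w 0) * (r 1 - w 1) - (q 1 - w 1) * (r 0 - w 0)) / D,
      ((r 0 - w 0) * (p 1 - w 1) - (r 1 - w 1) * (p 0 - w 0)) / D,
      ((p 0 - w 0) * (q 1 - w 1) - (p 1 - w 1) * (q 0 - w 0)) / D, ?_, ?_⟩
    · field_simp
      rw [hD]; ring
    · ext i
      fin_cases i
      · simp; field_simp; rw [hD]; ring
      · simp; field_simp; rw [hD]; ring

/-- A point `x` separated from three extreme points `p, q, r`, such that some halfplane contains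
`p` and `x` but neither `q` nor `r`, has exactly one negative barycentric coordinate, and it is not
the one at `p`. -/
theorem exists_barycentric_sign {p q r x : Plane}
    (hp : ∃ f : Plane, inner ℝ f q < inner ℝ f p ∧ inner ℝ f r < inner ℝ f p ∧
      inner ℝ f x < inner ℝ f p)
    (hq : ∃ f : Plane, inner ℝ f p < inner ℝ f q ∧ inner ℝ f r < inner ℝ f q ∧
      inner ℝ f x < inner ℝ f q)
    (hr : ∃ f : Plane, inner ℝ f p < inner ℝ f r ∧ inner ℝ f q < inner ℝ f r ∧
      inner ℝ f x < inner ℝ f r)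
    (hg : ∃ (g : Plane) (b : ℝ), b ≤ inner ℝ g p ∧ b ≤ inner ℝ g q ∧ b ≤ inner ℝ g r ∧
      inner ℝ g x < b)
    (hk : ∃ (k : Plane) (b : ℝ), b ≤ inner ℝ k p ∧ b ≤ inner ℝ k x ∧ inner ℝ k q < b ∧
      inner ℝ k r < b) :
    ∃ α β γ : ℝ, α + β + γ = 1 ∧ x = α • p + β • q + γ • r ∧ 0 < α ∧
      (0 < β ∧ γ < 0 ∨ β < 0 ∧ 0 < γ) := by
  obtain ⟨α, β, γ, hsum, hx⟩ := exists_barycentric_of_extreme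
    (hp.imp fun _ h => ⟨h.1, h.2.1⟩) (hq.imp fun _ h => ⟨h.1, h.2.1⟩)
    (hr.imp fun _ h => ⟨h.1, h.2.1⟩) x
  have hin : ∀ f : Plane,
      (inner ℝ f x : ℝ) = α * inner ℝ f p + β * inner ℝ f q + γ * inner ℝ f r := by
    intro f
    rw [hx, inner_add_right, inner_add_right, real_inner_smul_right, real_inner_smul_right,
      real_inner_smul_right]
  obtain ⟨f, hf1, hf2, hf3⟩ := hp
  obtain ⟨f', hf1', hf2', hf3'⟩ := hq
  obtain ⟨f'', hf1'', hf2'', hf3''⟩ := hr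
  obtain ⟨g, b, hg1, hg2, hg3, hg4⟩ := hg
  obtain ⟨k, b', hk1, hk2, hk3, hk4⟩ := hk
  rw [hin] at hf3 hf3' hf3'' hg4 hk2
  obtain rfl : α = 1 - β - γ := by linarith
  -- `x` is outside the triangle because `g` separates it. Two nonpositive weights would put the
  -- remaining vertex in the convex hull of `x` and the other two.
  have hneg : ¬ (0 ≤ 1 - β - γ ∧ 0 ≤ β ∧ 0 ≤ γ) := by
    rintro ⟨h1, h2, h3⟩
    nlinarith [mul_le_mul_of_nonneg_left hg1 h1, mul_le_mul_of_nonneg_left hg2 h2,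
      mul_le_mul_of_nonneg_left hg3 h3]
  have hp' : ¬ (β ≤ 0 ∧ γ ≤ 0) := by
    rintro ⟨h2, h3⟩
    nlinarith [mul_le_mul_of_nonpos_left hf1.le h2, mul_le_mul_of_nonpos_left hf2.le h3]
  have hq' : ¬ (1 - β - γ ≤ 0 ∧ γ ≤ 0) := by
    rintro ⟨h2, h3⟩
    nlinarith [mul_le_mul_of_nonpos_left hf1'.le h2, mul_le_mul_of_nonpos_left hf2'.le h3]
  have hr' : ¬ (1 - β - γ ≤ 0 ∧ β ≤ 0) := by
    rintro ⟨h2, h3⟩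
    nlinarith [mul_le_mul_of_nonpos_left hf1''.le h2, mul_le_mul_of_nonpos_left hf2''.le h3]
  have hα : 0 < 1 - β - γ := by
    by_contra! h
    have h2 : 0 < β := by by_contra! h'; exact hr' ⟨h, h'⟩
    have h3 : 0 < γ := by by_contra! h'; exact hq' ⟨h, h'⟩
    nlinarith [mul_le_mul_of_nonpos_left hk1 h, mul_lt_mul_of_pos_left hk3 h2,
      mul_lt_mul_of_pos_left hk4 h3]
  refine ⟨_, β, γ, hsum, hx, hα, ?_⟩
  by_cases hβ : 0 < β
  · exact Or.inl ⟨hβ, by by_contra! h; exact hneg ⟨hα.le, hβ.le, h⟩⟩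
  · have hγ : 0 < γ := by by_contra! h; exact hp' ⟨not_lt.1 hβ, h⟩
    exact Or.inr ⟨by by_contra! h; exact hneg ⟨hα.le, h, hγ.le⟩, hγ⟩

/-- Two points beyond two different sides of the triangle `p, q, r`, and separated from the
triangle, contain the common vertex `q` of the sides in their convex hull with `p` and `r`. -/
theorem false_of_barycentric_sign {p q r x y : Plane} {α β γ α' β' γ' : ℝ}
    (hsum : α + β + γ = 1) (hx : x = α • p + β • q + γ • r)
    (hα : 0 < α) (hβ : 0 < β) (hγ : γ < 0)
    (hsum' : α' + β' + γ' = 1) (hy : y = α' • p + β' • q + γ' • r)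
    (hα' : α' < 0) (hβ' : 0 < β') (hγ' : 0 < γ')
    (hq : ∃ f : Plane, inner ℝ f p < inner ℝ f q ∧ inner ℝ f r < inner ℝ f q ∧
      inner ℝ f x < inner ℝ f q ∧ inner ℝ f y < inner ℝ f q)
    (hg : ∃ (g : Plane) (b : ℝ), b ≤ inner ℝ g p ∧ b ≤ inner ℝ g q ∧ b ≤ inner ℝ g r ∧
      inner ℝ g x < b ∧ inner ℝ g y < b) : False := by
  obtain ⟨f, hf1, hf2, hf3, hf4⟩ := hq
  obtain ⟨g, b, hg1, hg2, hg3, hg4, hg5⟩ := hg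
  rw [hx, inner_add_right, inner_add_right, real_inner_smul_right, real_inner_smul_right,
    real_inner_smul_right] at hf3 hg4
  rw [hy, inner_add_right, inner_add_right, real_inner_smul_right, real_inner_smul_right,
    real_inner_smul_right] at hf4 hg5
  generalize (inner ℝ f p : ℝ) = fp at *
  generalize (inner ℝ f q : ℝ) = fq at *
  generalize (inner ℝ f r : ℝ) = fr at *
  generalize (inner ℝ g p : ℝ) = gp at *
  generalize (inner ℝ g q : ℝ) = gq at *
  generalize (inner ℝ g r : ℝ) = gr at *
  obtain rfl : β = 1 - α - γ := by linarith
  obtain rfl : β' = 1 - α' - γ' := by linarith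
  -- The values of `g` and of `f` force opposite strict signs on the determinant `α * γ' - γ * α'`.
  have h1 : α * (gp - b) < -γ * (gr - b) := by
    nlinarith [mul_nonneg hβ.le (sub_nonneg.2 hg2)]
  have h2 : γ' * (gr - b) < -α' * (gp - b) := by
    nlinarith [mul_nonneg hβ'.le (sub_nonneg.2 hg2)]
  have h3 : -γ * (fq - fr) < α * (fq - fp) := by nlinarith
  have h4 : -α' * (fq - fp) < γ' * (fq - fr) := by nlinarith
  have hR : 0 < gr - b := by
    by_contra! h
    nlinarith [mul_nonneg hα.le (sub_nonneg.2 hg1)]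
  have hA : 0 < fq - fp := by linarith
  have h5 : α * γ' < γ * α' := by
    have := mul_lt_mul_of_pos_left h2 hα
    have := mul_lt_mul_of_pos_left h1 (neg_pos.2 hα')
    by_contra! h
    nlinarith [mul_le_mul_of_nonneg_right h hR.le]
  have h6 : γ * α' < α * γ' := by
    have := mul_lt_mul_of_pos_left h4 (neg_pos.2 hγ)
    have := mul_lt_mul_of_pos_left h3 hγ'
    by_contra! h
    nlinarith [mul_le_mul_of_nonneg_right h hA.le]
  exact lt_asymm h5 h6

/-- Let `p, q, r` be extreme points of `P` such that `{p, q, r}` is a hyperedge. It is impossible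
that each of them lies in a hyperedge with at least three points that avoids the other two. -/
theorem false_of_private_edges {P : Set Plane} {p q r : Plane}
    (hpq : p ≠ q) (hpr : p ≠ r) (hqr : q ≠ r)
    (hp : {p} ∈ (halfplaneHypergraph P).edgeSet) (hq : {q} ∈ (halfplaneHypergraph P).edgeSet)
    (hr : {r} ∈ (halfplaneHypergraph P).edgeSet)
    (hpqr : {p, q, r} ∈ (halfplaneHypergraph P).edgeSet)
    (hp' : ∃ e ∈ (halfplaneHypergraph P).edgeSet, 3 ≤ e.ncard ∧ p ∈ e ∧ q ∉ e ∧ r ∉ e)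
    (hq' : ∃ e ∈ (halfplaneHypergraph P).edgeSet, 3 ≤ e.ncard ∧ q ∈ e ∧ p ∉ e ∧ r ∉ e)
    (hr' : ∃ e ∈ (halfplaneHypergraph P).edgeSet, 3 ≤ e.ncard ∧ r ∈ e ∧ p ∉ e ∧ q ∉ e) :
    False := by
  have hextr : ∀ {v : Plane}, {v} ∈ (halfplaneHypergraph P).edgeSet →
      ∃ f : Plane, ∀ w ∈ P, w ≠ v → inner ℝ f w < inner ℝ f v := by
    intro v hv
    obtain ⟨f, b, -, hf⟩ := mem_edgeSet_halfplaneHypergraph.1 hv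
    have hvv := (hf ▸ Set.mem_singleton v : v ∈ {x | x ∈ P ∧ b ≤ inner ℝ f x})
    refine ⟨f, fun w hw hwv => lt_of_lt_of_le (not_le.1 fun h => hwv ?_) hvv.2⟩
    have : w ∈ ({v} : Set Plane) := hf ▸ ⟨hw, h⟩
    exact this
  have hwit : ∀ {u v w : Plane}, u ∈ P → v ∈ P → w ∈ P →
      (∃ e ∈ (halfplaneHypergraph P).edgeSet, 3 ≤ e.ncard ∧ u ∈ e ∧ v ∉ e ∧ w ∉ e) →
      ∃ x ∈ P, x ≠ u ∧ x ≠ v ∧ x ≠ w ∧ ∃ (k : Plane) (b : ℝ), b ≤ inner ℝ k u ∧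
        b ≤ inner ℝ k x ∧ inner ℝ k v < b ∧ inner ℝ k w < b := by
    rintro u v w hu hv hw ⟨e, he, hcard, hue, hve, hwe⟩
    obtain ⟨k, b, -, rfl⟩ := mem_edgeSet_halfplaneHypergraph.1 he
    obtain ⟨x, hx, hxu⟩ := Set.exists_ne_of_one_lt_ncard (lt_of_lt_of_le (by norm_num) hcard) u
    exact ⟨x, hx.1, hxu, fun h => hve (h ▸ hx), fun h => hwe (h ▸ hx), k, b, hue.2, hx.2,
      not_le.1 fun h => hve ⟨hv, h⟩, not_le.1 fun h => hwe ⟨hw, h⟩⟩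
  have hsub := (halfplaneHypergraph P).subset_vertexSet_of_mem_edgeSet' hpqr
  have hpP : p ∈ P := hsub (by simp)
  have hqP : q ∈ P := hsub (by simp)
  have hrP : r ∈ P := hsub (by simp)
  obtain ⟨f, hf⟩ := hextr hp
  obtain ⟨f', hf'⟩ := hextr hq
  obtain ⟨f'', hf''⟩ := hextr hr
  obtain ⟨g, b, -, hg⟩ := mem_edgeSet_halfplaneHypergraph.1 hpqr
  have hgin : ∀ v ∈ ({p, q, r} : Set Plane), b ≤ inner ℝ g v := fun v hv => by
    rw [hg] at hv; exact hv.2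
  have hgp := hgin p (by simp)
  have hgq := hgin q (by simp)
  have hgr := hgin r (by simp)
  have hgout : ∀ v ∈ P, v ≠ p → v ≠ q → v ≠ r → inner ℝ g v < b := by
    intro v hv h1 h2 h3
    by_contra! h
    have : v ∈ ({p, q, r} : Set Plane) := by rw [hg]; exact ⟨hv, h⟩
    simp [h1, h2, h3] at this
  obtain ⟨x, hxP, hxp, hxq, hxr, hkx⟩ := hwit hpP hqP hrP hp'
  obtain ⟨y, hyP, hyq, hyp, hyr, hky⟩ := hwit hqP hpP hrP hq'
  obtain ⟨z, hzP, hzr, hzp, hzq, hkz⟩ := hwit hrP hpP hqP hr'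
  obtain ⟨α₁, β₁, γ₁, hs₁, hx, hα₁, h₁⟩ := exists_barycentric_sign (p := p) (q := q) (r := r)
    (x := x) ⟨f, hf _ hqP hpq.symm, hf _ hrP hpr.symm, hf _ hxP hxp⟩
    ⟨f', hf' _ hpP hpq, hf' _ hrP hqr.symm, hf' _ hxP hxq⟩
    ⟨f'', hf'' _ hpP hpr, hf'' _ hqP hqr, hf'' _ hxP hxr⟩
    ⟨g, b, hgp, hgq, hgr, hgout x hxP hxp hxq hxr⟩ hkx
  obtain ⟨β₂, α₂, γ₂, hs₂, hy, hβ₂, h₂⟩ := exists_barycentric_sign (p := q) (q := p) (r := r)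
    (x := y) ⟨f', hf' _ hpP hpq, hf' _ hrP hqr.symm, hf' _ hyP hyq⟩
    ⟨f, hf _ hqP hpq.symm, hf _ hrP hpr.symm, hf _ hyP hyp⟩
    ⟨f'', hf'' _ hqP hqr, hf'' _ hpP hpr, hf'' _ hyP hyr⟩
    ⟨g, b, hgq, hgp, hgr, hgout y hyP hyp hyq hyr⟩ hky
  obtain ⟨γ₃, α₃, β₃, hs₃, hz, hγ₃, h₃⟩ := exists_barycentric_sign (p := r) (q := p) (r := q)
    (x := z) ⟨f'', hf'' _ hpP hpr, hf'' _ hqP hqr, hf'' _ hzP hzr⟩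
    ⟨f, hf _ hrP hpr.symm, hf _ hqP hpq.symm, hf _ hzP hzp⟩
    ⟨f', hf' _ hrP hqr.symm, hf' _ hpP hpq, hf' _ hzP hzq⟩
    ⟨g, b, hgr, hgp, hgq, hgout z hzP hzp hzq hzr⟩ hkz
  have gx := hgout x hxP hxp hxq hxr
  have gy := hgout y hyP hyp hyq hyr
  have gz := hgout z hzP hzp hzq hzr
  -- The negative coordinate names the side crossed. Whenever two of `x, y, z` cross different
  -- sides, the vertex shared by those sides plays the role of `q`.
  rcases h₁ with ⟨hβ₁, hγ₁⟩ | ⟨hβ₁, hγ₁⟩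
  · rcases h₂ with ⟨hα₂, hγ₂⟩ | ⟨hα₂, hγ₂⟩
    · rcases h₃ with ⟨hα₃, hβ₃⟩ | ⟨hα₃, hβ₃⟩
      · exact false_of_barycentric_sign (p := q) (q := p) (r := r) (x := x) (y := z)
          (by linarith) (by rw [hx]; abel) hβ₁ hα₁ hγ₁
          (by linarith) (by rw [hz]; abel) hβ₃ hα₃ hγ₃
          ⟨f, hf _ hqP hpq.symm, hf _ hrP hpr.symm, hf _ hxP hxp, hf _ hzP hzp⟩
          ⟨g, b, hgq, hgp, hgr, gx, gz⟩
      · exact false_of_barycentric_sign (p := p) (q := q) (r := r) (x := x) (y := z)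
          (by linarith) (by rw [hx]) hα₁ hβ₁ hγ₁
          (by linarith) (by rw [hz]; abel) hα₃ hβ₃ hγ₃
          ⟨f', hf' _ hpP hpq, hf' _ hrP hqr.symm, hf' _ hxP hxq, hf' _ hzP hzq⟩
          ⟨g, b, hgp, hgq, hgr, gx, gz⟩
    · exact false_of_barycentric_sign (p := p) (q := q) (r := r) (x := x) (y := y)
        (by linarith) (by rw [hx]) hα₁ hβ₁ hγ₁
        (by linarith) (by rw [hy]; abel) hα₂ hβ₂ hγ₂
        ⟨f', hf' _ hpP hpq, hf' _ hrP hqr.symm, hf' _ hxP hxq, hf' _ hyP hyq⟩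
        ⟨g, b, hgp, hgq, hgr, gx, gy⟩
  · rcases h₂ with ⟨hα₂, hγ₂⟩ | ⟨hα₂, hγ₂⟩
    · exact false_of_barycentric_sign (p := r) (q := p) (r := q) (x := x) (y := y)
        (by linarith) (by rw [hx]; abel) hγ₁ hα₁ hβ₁
        (by linarith) (by rw [hy]; abel) hγ₂ hα₂ hβ₂
        ⟨f, hf _ hrP hpr.symm, hf _ hqP hpq.symm, hf _ hxP hxp, hf _ hyP hyp⟩
        ⟨g, b, hgr, hgp, hgq, gx, gy⟩
    · exact false_of_barycentric_sign (p := p) (q := r) (r := q) (x := x) (y := y)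
        (by linarith) (by rw [hx]; abel) hα₁ hγ₁ hβ₁
        (by linarith) (by rw [hy]; abel) hα₂ hγ₂ hβ₂
        ⟨f'', hf'' _ hpP hpr, hf'' _ hqP hqr, hf'' _ hxP hxr, hf'' _ hyP hyr⟩
        ⟨g, b, hgp, hgr, hgq, gx, gy⟩

/-! ### Two-colouring the points -/

/-- Finitely many points of the plane can be split in two classes such that every halfplane with
at least three points contains points of both classes. -/
theorem exists_bichromatic_of_halfplane {P : Set Plane} (hP : P.Finite) :
    ∃ N : Set Plane, ∀ e ∈ (halfplaneHypergraph P).edgeSet, 3 ≤ e.ncard →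
      (∃ p ∈ e, p ∈ N) ∧ ∃ q ∈ e, q ∉ N := by
  set E : Set Plane := {p | {p} ∈ (halfplaneHypergraph P).edgeSet} with hE
  have hEP : E ⊆ P := fun p hp =>
    (halfplaneHypergraph P).subset_vertexSet_of_mem_edgeSet' hp (Set.mem_singleton p)
  set C : Set (Set Plane) := {N | N ⊆ E ∧
    ∀ e ∈ (halfplaneHypergraph P).edgeSet, 3 ≤ e.ncard → ∃ p ∈ e, p ∈ N} with hC
  -- Each such hyperedge shrinks to a singleton, which is an extreme point.
  have hEC : E ∈ C := by
    refine ⟨subset_rfl, fun e he hcard => ?_⟩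
    obtain ⟨e', hsub, he', h1⟩ := exists_subset_mem_edgeSet_ncard_eq hP he (n := 1) (by omega)
    obtain ⟨p, rfl⟩ := Set.ncard_eq_one.1 h1
    exact ⟨p, hsub rfl, he'⟩
  have hCf : C.Finite := (hP.subset hEP).finite_subsets.subset fun N hN => hN.1
  obtain ⟨N, hN⟩ := hCf.exists_minimal ⟨E, hEC⟩
  have hpriv : ∀ p ∈ N, ∃ e ∈ (halfplaneHypergraph P).edgeSet, 3 ≤ e.ncard ∧
      p ∈ e ∧ ∀ q ∈ N, q ≠ p → q ∉ e := by
    intro p hp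
    by_contra! hcon
    have hmem : N \ {p} ∈ C := by
      refine ⟨Set.sdiff_subset.trans hN.prop.1, fun e he hcard => ?_⟩
      obtain ⟨q, hqe, hqN⟩ := hN.prop.2 e he hcard
      by_cases hqp : q = p
      · subst hqp
        obtain ⟨q', h1, h2, h3⟩ := hcon e he hcard hqe
        exact ⟨q', h3, h1, h2⟩
      · exact ⟨q, hqe, hqN, hqp⟩
    exact (hN.le_of_le hmem Set.sdiff_subset hp).2 rfl
  refine ⟨N, fun e he hcard => ⟨hN.prop.2 e he hcard, ?_⟩⟩
  obtain ⟨e', hsub, he', h3⟩ := exists_subset_mem_edgeSet_ncard_eq hP he hcard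
  by_contra! hall
  obtain ⟨p, q, r, hpq, hpr, hqr, rfl⟩ := Set.ncard_eq_three.1 h3
  have hpN := hall p (hsub (by simp))
  have hqN := hall q (hsub (by simp))
  have hrN := hall r (hsub (by simp))
  refine false_of_private_edges hpq hpr hqr (hN.prop.1 hpN) (hN.prop.1 hqN)
    (hN.prop.1 hrN) he' ?_ ?_ ?_
  · obtain ⟨e₁, h1, h2, h3, h4⟩ := hpriv p hpN
    exact ⟨e₁, h1, h2, h3, h4 q hqN hpq.symm, h4 r hrN hpr.symm⟩
  · obtain ⟨e₁, h1, h2, h3, h4⟩ := hpriv q hqN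
    exact ⟨e₁, h1, h2, h3, h4 p hpN hpq, h4 r hrN hqr.symm⟩
  · obtain ⟨e₁, h1, h2, h3, h4⟩ := hpriv r hrN
    exact ⟨e₁, h1, h2, h3, h4 p hpN hpr, h4 q hqN hqr⟩

/-! ### From points to tuples, and the exact value -/

open Classical in
/-- If a point colouring with classes `N` and its complement is bichromatic on every hyperedge with
more than `t` vertices, colouring `t`-tuples by the parity of their number of points in `N` is
`(t, 2, t + 1)`-polychromatic. -/
theorem Hypergraph.exists_isPolychromatic_two {α : Type*} {H : Hypergraph α} {t : ℕ} {N : Set α}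
    (hfin : ∀ e ∈ H.edgeSet, e.Finite)
    (hN : ∀ e ∈ H.edgeSet, t + 1 ≤ e.ncard → (∃ p ∈ e, p ∈ N) ∧ ∃ q ∈ e, q ∉ N) (ht : 1 ≤ t) :
    ∃ c : H.Tuple t → Fin 2, H.IsPolychromatic (t + 1) c := by
  refine ⟨fun s => Fin.ofNat 2 (s.1.filter (· ∈ N)).card, fun e he hcard i => ?_⟩
  have hef := hfin e he
  have hcard' : t + 1 ≤ e.ncard := by
    rw [← hef.cast_ncard_eq] at hcard
    exact_mod_cast hcard
  obtain ⟨⟨p, hpe, hpN⟩, q, hqe, hqN⟩ := hN e he hcard'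
  have hpq : p ≠ q := fun h => hqN (h ▸ hpN)
  obtain ⟨S, hS1, hS2, hS3⟩ := Finset.exists_subsuperset_card_eq (s := {p, q})
    (t := hef.toFinset) (n := t + 1)
    (by intro x hx; simp at hx; rcases hx with rfl | rfl <;> simpa)
    (by rw [Finset.card_pair hpq]; omega) (by rwa [← Set.ncard_eq_toFinset_card e hef])
  have hpS : p ∈ S := hS1 (by simp)
  have hqS : q ∈ S := hS1 (by simp)
  have hSe : (S : Set α) ⊆ e := fun x hx => by simpa using hS2 hx
  have htup : ∀ x ∈ S, ((S.erase x : Finset α) : Set α) ⊆ H.vertexSet ∧ (S.erase x).card = t :=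
    fun x hx => ⟨fun y hy => H.subset_vertexSet_of_mem_edgeSet' he
      (hSe (Finset.mem_of_mem_erase hy)), by rw [Finset.card_erase_of_mem hx, hS3]; rfl⟩
  have hsub : ∀ x, ((S.erase x : Finset α) : Set α) ⊆ e :=
    fun x y hy => hSe (Finset.mem_of_mem_erase hy)
  have h1 : ((S.erase p).filter (· ∈ N)).card + 1 = (S.filter (· ∈ N)).card := by
    rw [Finset.filter_erase, Finset.card_erase_add_one (by simp [hpS, hpN])]
  have h2 : ((S.erase q).filter (· ∈ N)).card = (S.filter (· ∈ N)).card := by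
    rw [Finset.filter_erase, Finset.erase_eq_of_notMem (by simp [hqN])]
  by_cases hi : Fin.ofNat 2 ((S.erase p).filter (· ∈ N)).card = i
  · exact ⟨⟨S.erase p, htup p hpS⟩, hsub p, hi⟩
  · refine ⟨⟨S.erase q, htup q hqS⟩, hsub q, ?_⟩
    show Fin.ofNat 2 ((S.erase q).filter (· ∈ N)).card = i
    rw [h2, ← h1]
    simp only [Fin.ext_iff, Fin.ofNat] at hi ⊢
    omega

/-- A finite point set is one of its own hyperedges. -/
theorem self_mem_edgeSet_halfplaneHypergraph {P : Set Plane} (hP : P.Finite) :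
    P ∈ (halfplaneHypergraph P).edgeSet := by
  obtain ⟨a, ha⟩ := exists_ne (0 : Plane)
  obtain ⟨b, hb⟩ := (hP.image fun x => (inner ℝ a x : ℝ)).bddBelow
  refine mem_edgeSet_halfplaneHypergraph.2 ⟨a, b, ha, ?_⟩
  ext x
  exact ⟨fun hx => ⟨hx, hb ⟨x, hx, rfl⟩⟩, fun hx => hx.1⟩

theorem mainTheorem10 (t : ℕ) (ht : 2 ≤ t) :
    familyPolychromaticNumber halfplaneFamily t 2 = (t : ℕ∞) + 1 := by
  apply le_antisymm
  · refine iSup₂_le ?_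
    rintro H ⟨P, hP, rfl⟩
    obtain ⟨N, hN⟩ := exists_bichromatic_of_halfplane hP
    have hc := Hypergraph.exists_isPolychromatic_two (H := halfplaneHypergraph P) (t := t) (N := N)
      (fun e he => hP.subset ((halfplaneHypergraph P).subset_vertexSet_of_mem_edgeSet' he))
      (fun e he hcard => hN e he (by omega)) (by omega)
    exact (iInf₂_le (t + 1) hc).trans (by simp)
  -- On exactly `t` points the whole set is a hyperedge with a single `t`-tuple, which cannot have
  -- both colours; so no `f ≤ t` works.
  · obtain ⟨S, hS⟩ := Infinite.exists_subset_card_eq Plane t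
    refine le_iSup₂_of_le (halfplaneHypergraph (S : Set Plane)) ⟨S, S.finite_toSet, rfl⟩ ?_
    refine le_iInf₂ ?_
    rintro f ⟨c, hc⟩
    by_contra! hlt
    have hft : f ≤ t := by
      have : f < t + 1 := by exact_mod_cast hlt
      omega
    have key : ∀ s : (halfplaneHypergraph (S : Set Plane)).Tuple t, s.1 = S := fun s =>
      Finset.eq_of_subset_of_card_le (Finset.coe_subset.1 s.2.1) (by rw [s.2.2, hS])
    have hpoly := hc _ (self_mem_edgeSet_halfplaneHypergraph S.finite_toSet)
      (by rw [Set.encard_coe_eq_coe_finsetCard, hS]; exact_mod_cast hft)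
    obtain ⟨s₀, -, h₀⟩ := hpoly 0
    obtain ⟨s₁, -, h₁⟩ := hpoly 1
    have : s₀ = s₁ := Subtype.ext ((key s₀).trans (key s₁).symm)
    rw [this, h₁] at h₀
    exact absurd h₀ (by decide)
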